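/- All graphs are finite and undirected, have no loops, and may have multiple edges. A bipartite graph is \emph{$(a,b)$-biregular} if all vertices in one part have degree $a$ and all vertices in the other part have degree $b$. An \emph{interval $t$-coloring} of a graph is an edge coloring with colors $1,\dots,t$ such that, at every vertex, the colors of the edges incident to that vertex are distinct and form an interval of integers (the empty set being allowed at isolated vertices); a graph is \emph{interval colorable} if it has an interval $t$-coloring for some integer $t$. The \emph{interval coloring thickness} $\theta_{\mathrm{int}}(G)$ is the minimum positive integer $n$ for which there is a list of $n$ interval colorable subgraphs of $G$ such that every edge of $G$ appears in exactly one subgraph in the list. Let $G$ be a bipartite graph. (i) If $G$ is $(3,3r)$-biregular for some integer $r\ge 2$, then $\theta_{\mathrm{int}}(G)\le 2$. (ii) If $G$ is $(k,kr)$-biregular for some integers $k\ge 4$ and $r\ge 2$, then $\theta_{\mathrm{int}}(G)\le k-2$. -/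

import Mathlib

namespace Graph

variable {α β : Type*}

/-- The degree of a vertex of a loopless multigraph: the number of edges incident with it
(parallel edges are counted separately). -/
noncomputable def edgeDegree (G : Graph α β) (v : α) : ℕ :=
  (G.incidenceSet v).ncard

/-- `G` is bipartite with parts `X` and `Y`: the two sets partition the vertex set and every
edge joins a vertex of `X` to a vertex of `Y`. -/
structure IsBipartition (G : Graph α β) (X Y : Set α) : Prop where
  union_eq : X ∪ Y = G.vertexSet
  disjoint : Disjoint X Y
  ends : ∀ ⦃e x y⦄, G.IsLink e x y → (x ∈ X ∧ y ∈ Y) ∨ (x ∈ Y ∧ y ∈ X)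

/-- `G` is an `(a, b)`-biregular bipartite graph: for some bipartition, all vertices of one part
have degree `a` and all vertices of the other part have degree `b`. -/
def IsBiregularBipartite (G : Graph α β) (a b : ℕ) : Prop :=
  ∃ X Y : Set α, G.IsBipartition X Y ∧
    (∀ x ∈ X, G.edgeDegree x = a) ∧ (∀ y ∈ Y, G.edgeDegree y = b)

/-- `c` is a proper edge coloring of `G` with colors from `{1, …, t}` (only the values of `c` on
edges of `G` matter): distinct edges with a common end receive distinct colors. -/
structure IsProperEdgeColoring (G : Graph α β) (t : ℕ) (c : β → ℕ) : Prop where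
  mem_colors : ∀ e ∈ G.edgeSet, c e ∈ Set.Icc 1 t
  proper : ∀ ⦃v e f⦄, G.Inc e v → G.Inc f v → e ≠ f → c e ≠ c f

/-- An interval `t`-coloring: a proper `t`-edge coloring such that the colors on the edges
incident with any given vertex form an interval of integers (possibly empty, at a vertex
without edges). -/
structure IsIntervalColoring (G : Graph α β) (t : ℕ) (c : β → ℕ) : Prop
    extends G.IsProperEdgeColoring t c where
  interval : ∀ v ∈ G.vertexSet, ∃ a b : ℕ, c '' G.incidenceSet v = Set.Icc a b

/-- `G` is interval colorable if it has an interval `t`-coloring for some `t`. -/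
def IntervalColorable (G : Graph α β) : Prop :=
  ∃ (t : ℕ) (c : β → ℕ), G.IsIntervalColoring t c

/-- `H 0, …, H (n - 1)` is a decomposition of `G` into interval colorable subgraphs: every edge
of `G` lies in exactly one member of the list. -/
structure IsIntervalDecomposition (G : Graph α β) {n : ℕ} (H : Fin n → Graph α β) : Prop where
  subgraph : ∀ i, H i ≤ G
  colorable : ∀ i, (H i).IntervalColorable
  existsUnique : ∀ e ∈ G.edgeSet, ∃! i, e ∈ (H i).edgeSet

/-- The interval coloring thickness of `G`: the least positive integer `n` such that `G` has a
decomposition into `n` interval colorable subgraphs (and `⊤` if there were none). -/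
noncomputable def intervalThickness (G : Graph α β) : ℕ∞ :=
  sInf {m : ℕ∞ | ∃ n : ℕ, 1 ≤ n ∧ m = (n : ℕ∞) ∧
    ∃ H : Fin n → Graph α β, G.IsIntervalDecomposition H}

end Graph

/-! The bound proved is `⌈k / 2⌉`, which is 2 for `k = 3` and at most `k - 2` for `k ≥ 4`. Splitting
each vertex of degree `k * r` into `r` vertices of degree `k` gives a `k`-regular bipartite
multigraph, whose edges König's theorem partitions into `k` perfect matchings. After merging back,
each class meets every vertex of degree `k` once and every other vertex `r` times
(`exists_edgeColoring_of_biregular`).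

The classes are grouped in pairs, with a single one left over if `k` is odd. The union of a pair is
interval colorable (`exists_intervalColoring_of_layers`): each vertex `a` of degree 2 is read as an
edge joining its two neighbors, taken in two separate copies of the other part. This is an
`r`-regular bipartite multigraph. If König's theorem gives `a` the color `d`, the two edges at `a`
receive `2 * d + 1` and `2 * d + 2`. -/

open Finset

/-! ### König's theorem for multigraphs given by two end maps -/

section FiberwiseColorings

variable {ε A B : Type*} [DecidableEq A] [DecidableEq B]

theorem card_filter_mem_of_card_fiber (f : ε → A) (s : Finset ε) {k : ℕ}
    (hf : ∀ a, #{e ∈ s | f e = a} = k) (S : Finset A) : #{e ∈ s | f e ∈ S} = #S * k := by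
  have hmaps : ∀ e ∈ ({e ∈ s | f e ∈ S} : Finset ε), f e ∈ S := fun e he => (mem_filter.1 he).2
  rw [card_eq_sum_card_fiberwise hmaps, sum_const_nat]
  intro a ha
  rw [← hf a, filter_filter]
  congr 1
  ext e
  simp only [mem_filter]
  exact ⟨fun h => ⟨h.1, h.2.2⟩, fun h => ⟨h.1, h.2 ▸ ha, h.2⟩⟩

/-- A regular bipartite multigraph of positive degree, given by the end maps `f` and `g` of its
edge set `s`, has a perfect matching. -/
theorem exists_perfectMatching_of_regular [Fintype A] [Fintype B]
    [DecidableEq ε] (f : ε → A) (g : ε → B) (s : Finset ε) {k : ℕ}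
    (hk : 0 < k) (hf : ∀ a, #{e ∈ s | f e = a} = k) (hg : ∀ b, #{e ∈ s | g e = b} = k) :
    ∃ M ⊆ s, (∀ a, #{e ∈ M | f e = a} = 1) ∧ ∀ b, #{e ∈ M | g e = b} = 1 := by
  -- Hall's condition by double counting: the `k * #S` edges leaving `S` all end in its neighborhood
  -- `T`, which meets only `k * #T` edges.
  have hall : ∀ S : Finset A, #S ≤ #(S.biUnion fun a => {e ∈ s | f e = a}.image g) := by
    intro S
    set T := S.biUnion fun a => {e ∈ s | f e = a}.image g
    have h3 : #{e ∈ s | f e ∈ S} ≤ #{e ∈ s | g e ∈ T} := by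
      refine card_le_card fun e he => ?_
      simp only [mem_filter] at he ⊢
      refine ⟨he.1, mem_biUnion.2 ⟨f e, he.2, mem_image.2 ⟨e, ?_, rfl⟩⟩⟩
      simp [he.1]
    rw [card_filter_mem_of_card_fiber f s hf, card_filter_mem_of_card_fiber g s hg] at h3
    exact Nat.le_of_mul_le_mul_right h3 hk
  obtain ⟨φ, hφ, hmem⟩ := (all_card_le_biUnion_card_iff_exists_injective _).1 hall
  have hex : ∀ a, ∃ e ∈ s, f e = a ∧ g e = φ a := by
    intro a
    obtain ⟨e, he, heq⟩ := mem_image.1 (hmem a)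
    exact ⟨e, (mem_filter.1 he).1, (mem_filter.1 he).2, heq⟩
  choose m hms hmf hmg using hex
  -- Counting all edges from both sides makes the two parts equal in size, so the matching also
  -- covers `B`.
  have hcard : Fintype.card A = Fintype.card B := by
    have h1 := card_filter_mem_of_card_fiber f s hf univ
    have h2 := card_filter_mem_of_card_fiber g s hg univ
    simp only [mem_univ, filter_true, card_univ] at h1 h2
    exact Nat.eq_of_mul_eq_mul_right hk (h1.symm.trans h2)
  have hbij : Function.Bijective φ := (Fintype.bijective_iff_injective_and_card φ).2 ⟨hφ, hcard⟩
  refine ⟨univ.image m, ?_, fun a => ?_, fun b => ?_⟩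
  · intro e he
    obtain ⟨a, -, rfl⟩ := mem_image.1 he
    exact hms a
  · refine card_eq_one.2 ⟨m a, ?_⟩
    ext e
    simp only [mem_filter, mem_image, mem_univ, true_and, mem_singleton]
    constructor
    · rintro ⟨⟨a', rfl⟩, h⟩
      rw [hmf] at h
      rw [h]
    · rintro rfl
      exact ⟨⟨a, rfl⟩, hmf a⟩
  · obtain ⟨a, rfl⟩ := hbij.2 b
    refine card_eq_one.2 ⟨m a, ?_⟩
    ext e
    simp only [mem_filter, mem_image, mem_univ, true_and, mem_singleton]
    constructor
    · rintro ⟨⟨a', rfl⟩, h⟩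
      rw [hmg] at h
      rw [hφ h]
    · rintro rfl
      exact ⟨⟨a, rfl⟩, hmg a⟩

/-- König's edge coloring theorem for `k`-regular bipartite multigraphs: the edges can be colored
with `k` colors so that every color appears exactly once at every vertex. -/
theorem exists_edgeColoring_of_regular [Fintype A] [Fintype B]
    [DecidableEq ε] (f : ε → A) (g : ε → B) (s : Finset ε) (k : ℕ)
    (hf : ∀ a, #{e ∈ s | f e = a} = k) (hg : ∀ b, #{e ∈ s | g e = b} = k) :
    ∃ c : ε → ℕ, (∀ e ∈ s, c e < k) ∧ (∀ a, ∀ i < k, #{e ∈ s | f e = a ∧ c e = i} = 1) ∧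
      ∀ b, ∀ i < k, #{e ∈ s | g e = b ∧ c e = i} = 1 := by
  induction k generalizing s with
  | zero =>
    refine ⟨fun _ => 0, fun e he => ?_, by simp, by simp⟩
    exact absurd rfl (filter_eq_empty_iff.1 (card_eq_zero.1 (hf (f e))) he)
  | succ k ih =>
    obtain ⟨M, hMs, hMf, hMg⟩ := exists_perfectMatching_of_regular f g s k.succ_pos hf hg
    have hsdiff : ∀ p : ε → Prop, ∀ [DecidablePred p], #{e ∈ s | p e} = k + 1 →
        #{e ∈ M | p e} = 1 → #{e ∈ s \ M | p e} = k := by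
      intro p _ h1 h2
      have h3 : {e ∈ s \ M | p e} = {e ∈ s | p e} \ {e ∈ M | p e} := by
        ext e
        simp only [mem_filter, mem_sdiff]
        tauto
      rw [h3, card_sdiff_of_subset (filter_subset_filter _ hMs), h1, h2]
      rfl
    obtain ⟨c, hc, hcf, hcg⟩ := ih (s \ M) (fun a => hsdiff _ (hf a) (hMf a))
      (fun b => hsdiff _ (hg b) (hMg b))
    have hcol : ∀ p : ε → Prop, ∀ [DecidablePred p], #{e ∈ M | p e} = 1 →
        (∀ i < k, #{e ∈ s \ M | p e ∧ c e = i} = 1) →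
        ∀ i < k + 1, #{e ∈ s | p e ∧ (if e ∈ M then k else c e) = i} = 1 := by
      intro p _ h1 h2 i hi
      rcases Nat.lt_succ_iff_lt_or_eq.1 hi with hi | rfl
      · rw [← h2 i hi]
        congr 1
        ext e
        simp only [mem_filter, mem_sdiff]
        by_cases he : e ∈ M
        · simp [he, hi.ne']
        · simp [he]
      · rw [← h1]
        congr 1
        ext e
        simp only [mem_filter]
        by_cases he : e ∈ M
        · simp [he, hMs he]
        · simp only [he, if_false, false_and, iff_false]
          rintro ⟨hs, -, h⟩
          exact (hc e (mem_sdiff.2 ⟨hs, he⟩)).ne h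
    refine ⟨fun e => if e ∈ M then k else c e, fun e he => ?_, fun a => hcol _ (hMf a) (hcf a),
      fun b => hcol _ (hMg b) (hcg b)⟩
    by_cases heM : e ∈ M
    · simp [heM]
    · simpa [heM] using (hc e (mem_sdiff.2 ⟨he, heM⟩)).trans k.lt_succ_self

/-! ### Splitting the vertices of large degree -/

/-- A set of `k * r` elements can be split into `r` labelled parts of size `k`. -/
theorem exists_equipartition [DecidableEq ε] (t : Finset ε) {k r : ℕ} (hr : 0 < r) (ht : #t = k * r) :
    ∃ h : ε → Fin r, ∀ j, #{e ∈ t | h e = j} = k := by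
  have hcard : Fintype.card t = Fintype.card (Fin r × Fin k) := by
    simp [ht, mul_comm]
  let φ := Fintype.equivOfCardEq hcard
  refine ⟨fun e => if he : e ∈ t then (φ ⟨e, he⟩).1 else ⟨0, hr⟩, fun j => ?_⟩
  have hk : #(univ : Finset (Fin k)) = k := by simp
  refine Eq.trans (Eq.symm ?_) hk
  refine card_bij (fun i _ => (φ.symm (j, i)).1) (fun i _ => ?_) (fun i _ i' _ h => ?_)
    (fun e he => ?_)
  · simp
  · simpa using φ.symm.injective (Subtype.ext h)
  · obtain ⟨het, hej⟩ := mem_filter.1 he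
    simp only [dif_pos het] at hej
    refine ⟨(φ ⟨e, het⟩).2, mem_univ _, ?_⟩
    rw [← hej]
    simp

/-- The edges of a `(k, k * r)`-biregular bipartite multigraph can be colored with `k` colors so
that every color appears once at each vertex of degree `k` and `r` times at each vertex of degree
`k * r`. -/
theorem exists_edgeColoring_of_biregular [Fintype A] [Fintype B]
    [DecidableEq ε] (f : ε → A) (g : ε → B) (s : Finset ε) {k r : ℕ}
    (hr : 0 < r) (hf : ∀ a, #{e ∈ s | f e = a} = k) (hg : ∀ b, #{e ∈ s | g e = b} = k * r) :
    ∃ c : ε → ℕ, (∀ e ∈ s, c e < k) ∧ (∀ a, ∀ i < k, #{e ∈ s | f e = a ∧ c e = i} = 1) ∧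
      ∀ b, ∀ i < k, #{e ∈ s | g e = b ∧ c e = i} = r := by
  -- The pairs `(b, j)` with `j : Fin r` are the copies of `b`; an edge `e` at `b` is attached to
  -- the copy `h b e`.
  choose h hh using fun b => exists_equipartition {e ∈ s | g e = b} hr (hg b)
  obtain ⟨c, hc, hcf, hcg⟩ := exists_edgeColoring_of_regular f
    (fun e => (g e, h (g e) e)) s k hf (by
      rintro ⟨b, j⟩
      rw [← hh b j, filter_filter]
      congr 1
      ext e
      simp only [mem_filter, Prod.mk.injEq]
      exact and_congr_right fun _ => and_congr_right fun hb => by rw [hb])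
  refine ⟨c, hc, hcf, fun b i hi => ?_⟩
  rw [card_eq_sum_card_fiberwise (f := h b) (t := univ) (fun _ _ => mem_univ _),
    sum_const_nat (m := 1)]
  · simp
  · intro j _
    rw [← hcg (b, j) i hi, filter_filter]
    congr 1
    ext e
    simp only [mem_filter, Prod.mk.injEq]
    constructor
    · rintro ⟨h1, ⟨rfl, h2⟩, h3⟩
      exact ⟨h1, ⟨rfl, h3⟩, h2⟩
    · rintro ⟨h1, ⟨rfl, h3⟩, h2⟩
      exact ⟨h1, ⟨rfl, h2⟩, h3⟩

/-! ### Interval colorings of one or two layers -/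

/-- A coloring that is injective on `S` and whose values on `S` form an interval. -/
def IsIntervalOn (col : ε → ℕ) (S : Set ε) : Prop :=
  Set.InjOn col S ∧ ∃ a b, col '' S = Set.Icc a b

/-- An injective coloring of `n` elements with colors from `{a + 1, …, a + n}` is an interval
coloring. -/
theorem isIntervalOn_of_card {col : ε → ℕ} {S : Finset ε} {a n : ℕ} (hinj : Set.InjOn col S)
    (hmem : ∀ e ∈ S, a < col e ∧ col e ≤ a + n) (hn : #S = n) : IsIntervalOn col (S : Set ε) := by
  refine ⟨hinj, a + 1, a + n, ?_⟩
  have : S.image col = Icc (a + 1) (a + n) := by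
    refine eq_of_subset_of_card_le (fun i hi => ?_) ?_
    · obtain ⟨e, he, rfl⟩ := mem_image.1 hi
      exact mem_Icc.2 (hmem e he)
    · rw [card_image_of_injOn hinj, hn, Nat.card_Icc]
      omega
  rw [← coe_image, this, coe_Icc]

/-- A union of `m ≤ 2` layers, each meeting every fiber of `f` once and every fiber of `g` exactly
`r` times, has an interval coloring. -/
theorem exists_intervalColoring_of_layers [Fintype A] [Fintype B]
    [DecidableEq ε] (f : ε → A) (g : ε → B) (s : Finset ε) {m r : ℕ}
    (hm : 0 < m) (hm2 : m ≤ 2) (l : ε → ℕ) (hl : ∀ e ∈ s, l e < m)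
    (hf : ∀ a, ∀ i < m, #{e ∈ s | f e = a ∧ l e = i} = 1)
    (hg : ∀ b, ∀ i < m, #{e ∈ s | g e = b ∧ l e = i} = r) :
    ∃ (t : ℕ) (col : ε → ℕ), (∀ e ∈ s, col e ∈ Set.Icc 1 t) ∧
      (∀ a, IsIntervalOn col {e | e ∈ s ∧ f e = a}) ∧
      ∀ b, IsIntervalOn col {e | e ∈ s ∧ g e = b} := by
  -- The bound `i < m` sits inside the existential to make `u` total; for `i ≥ m` its value is
  -- arbitrary.
  have hex : ∀ i a, ∃ e, i < m → {e ∈ s | f e = a ∧ l e = i} = {e} := by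
    intro i a
    by_cases hi : i < m
    · exact (card_eq_one.1 (hf a i hi)).imp fun e he _ => he
    · exact (card_eq_one.1 (hf a 0 hm)).imp fun e _ h => absurd h hi
  choose u hu using hex
  have hu' : ∀ i < m, ∀ a, u i a ∈ s ∧ f (u i a) = a ∧ l (u i a) = i := by
    intro i hi a
    have : u i a ∈ ({e ∈ s | f e = a ∧ l e = i} : Finset ε) := by
      rw [hu i a hi]
      exact mem_singleton_self _
    simpa using this
  have huniq : ∀ e ∈ s, u (l e) (f e) = e := by
    intro e he
    have : e ∈ ({e' ∈ s | f e' = f e ∧ l e' = l e} : Finset ε) := by simp [he]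
    rw [hu _ _ (hl e he), mem_singleton] at this
    exact this.symm
  -- The map `u i` is a bijection from `A` onto layer `i`, so edges of a layer may be counted as
  -- elements of `A`.
  have htransfer : ∀ i < m, ∀ (p : A → ε → Prop) [∀ a e, Decidable (p a e)],
      #{a | p a (u i a)} = #{e ∈ s | p (f e) e ∧ l e = i} := by
    intro i hi p _
    refine card_bij (fun a _ => u i a) (fun a ha => ?_) (fun a _ a' _ h => ?_) (fun e he => ?_)
    · obtain ⟨h1, h2, h3⟩ := hu' i hi a
      simpa [h1, h2, h3] using ha
    · rw [← (hu' i hi a).2.1, h, (hu' i hi a').2.1]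
    · obtain ⟨hes, hp, rfl⟩ := mem_filter.1 he
      exact ⟨f e, by simpa [huniq e hes] using hp, huniq e hes⟩
  have hfib : ∀ i < m, ∀ b, #{a | g (u i a) = b} = r := fun i hi b => by
    rw [htransfer i hi fun _ e => g e = b, hg b i hi]
  -- The auxiliary multigraph: `a` joins the `g`-ends of its edges in the first and last layers. For
  -- `m = 1` these two edges coincide.
  obtain ⟨d, hd, hd0, hd1⟩ := exists_edgeColoring_of_regular (fun a => g (u 0 a))
    (fun a => g (u (m - 1) a)) univ r (hfib 0 hm) (hfib (m - 1) (by omega))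
  have hone : ∀ b, ∀ i < m, ∀ j < r, #{e ∈ s | (g e = b ∧ d (f e) = j) ∧ l e = i} = 1 := by
    intro b i hi j hj
    rw [← htransfer i hi fun a e => g e = b ∧ d a = j]
    -- Here `m ≤ 2` is essential: an edge of the auxiliary multigraph has only two ends, so `d`
    -- controls only two layers.
    obtain rfl | rfl : i = 0 ∨ i = m - 1 := by omega
    · exact hd0 b j hj
    · exact hd1 b j hj
  have hsplit : ∀ e ∈ s, ∀ e' ∈ s, m * d (f e) + l e + 1 = m * d (f e') + l e' + 1 →
      d (f e) = d (f e') ∧ l e = l e' := by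
    intro e he e' he' h
    have h1 := hl e he
    have h2 := hl e' he'
    obtain rfl | rfl : m = 1 ∨ m = 2 := by omega
    · omega
    · omega
  have hsum : ∀ (p : ε → Prop) [DecidablePred p] (q : ℕ),
      (∀ i < m, #{e ∈ s | p e ∧ l e = i} = q) → #{e ∈ s | p e} = m * q := by
    intro p _ q h
    rw [card_eq_sum_card_fiberwise (f := l) (t := range m)
      (fun e he => mem_coe.2 (mem_range.2 (hl e (mem_filter.1 he).1))), sum_const_nat (m := q)]
    · simp
    · intro i hi
      rw [filter_filter, h i (mem_range.1 hi)]
  have hle : ∀ e ∈ s, m * d (f e) + l e + 1 ≤ m * r := by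
    intro e he
    have h1 := hl e he
    have h2 : d (f e) + 1 ≤ r := hd (f e) (mem_univ _)
    calc m * d (f e) + l e + 1 ≤ m * (d (f e) + 1) := by rw [mul_add]; omega
      _ ≤ m * r := Nat.mul_le_mul_left m h2
  -- At `a` the value `d a` is fixed and the layer varies, giving `m` consecutive colors. At `b`
  -- every pair of a value of `d` and a layer occurs exactly once, giving all of `1, …, m * r`.
  refine ⟨m * r, fun e => m * d (f e) + l e + 1, fun e he => ⟨Nat.le_add_left _ _, hle e he⟩,
    fun a => ?_, fun b => ?_⟩
  · have := isIntervalOn_of_card (col := fun e => m * d (f e) + l e + 1)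
      (S := {e ∈ s | f e = a}) (a := m * d a) (n := m) ?_ ?_ (by simpa using hsum _ 1 (hf a))
    · simpa using this
    · intro e he e' he' h
      obtain ⟨hes, rfl⟩ := mem_filter.1 (mem_coe.1 he)
      obtain ⟨hes', hf'⟩ := mem_filter.1 (mem_coe.1 he')
      rw [← huniq e hes, ← huniq e' hes', (hsplit e hes e' hes' h).2, hf']
    · intro e he
      obtain ⟨hes, rfl⟩ := mem_filter.1 he
      have := hl e hes
      constructor <;> omega
  · have := isIntervalOn_of_card (col := fun e => m * d (f e) + l e + 1)
      (S := {e ∈ s | g e = b}) (a := 0) (n := m * r) ?_ ?_ (hsum _ r (hg b))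
    · simpa using this
    · intro e he e' he' h
      obtain ⟨hes, rfl⟩ := mem_filter.1 (mem_coe.1 he)
      obtain ⟨hes', hg'⟩ := mem_filter.1 (mem_coe.1 he')
      obtain ⟨h1, h2⟩ := hsplit e hes e' hes' h
      refine card_le_one.1 (hone (g e) (l e) (hl e hes) (d (f e)) (hd _ (mem_univ _))).le e ?_ e' ?_
      · simp [hes]
      · simp [hes', hg', h1, h2]
    · intro e he
      have := hle e (mem_filter.1 he).1
      constructor <;> omega

end FiberwiseColorings

/-! ### Transfer to `Graph` and the thickness bound -/

namespace Graph

variable {α β : Type*}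

theorem intervalThickness_le_of_decomposition (G : Graph α β) {n : ℕ} (hn : 1 ≤ n)
    (H : Fin n → Graph α β) (hH : G.IsIntervalDecomposition H) : G.intervalThickness ≤ n :=
  sInf_le ⟨n, hn, rfl, H, hH⟩

/-- In a bipartite graph, every edge has an end in each part, and these ends determine
incidence. -/
theorem IsBipartition.exists_ends {G : Graph α β} {X Y : Set α} (h : G.IsBipartition X Y) :
    ∃ (f : G.edgeSet → X) (g : G.edgeSet → Y),
      (∀ (e : G.edgeSet) (x : X), G.Inc e x ↔ f e = x) ∧
        ∀ (e : G.edgeSet) (y : Y), G.Inc e y ↔ g e = y := by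
  have hex : ∀ e : G.edgeSet, ∃ (x : X) (y : Y), G.IsLink e x y := by
    rintro ⟨e, he⟩
    obtain ⟨x, y, hl⟩ := G.exists_isLink_of_mem_edgeSet he
    rcases h.ends hl with ⟨hx, hy⟩ | ⟨hx, hy⟩
    · exact ⟨⟨x, hx⟩, ⟨y, hy⟩, hl⟩
    · exact ⟨⟨y, hy⟩, ⟨x, hx⟩, hl.symm⟩
  choose f g hfg using hex
  have hne : ∀ (x : X) (y : Y), (x : α) ≠ y := fun x y hxy =>
    Set.disjoint_left.1 h.disjoint x.2 (hxy ▸ y.2)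
  refine ⟨f, g, fun e x => ⟨fun hi => ?_, ?_⟩, fun e y => ⟨fun hi => ?_, ?_⟩⟩
  · rcases hi.eq_or_eq_of_isLink (hfg e) with h' | h'
    · exact Subtype.ext h'.symm
    · exact absurd h' (hne _ _)
  · rintro rfl
    exact (hfg e).inc_left
  · rcases hi.eq_or_eq_of_isLink (hfg e) with h' | h'
    · exact absurd h'.symm (hne _ _)
    · exact Subtype.ext h'.symm
  · rintro rfl
    exact (hfg e).inc_right

theorem edgeDegree_eq_card_filter {G : Graph α β} [Fintype G.edgeSet] {v : α}
    {p : G.edgeSet → Prop} [DecidablePred p] (h : ∀ e : G.edgeSet, G.Inc e v ↔ p e) :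
    G.edgeDegree v = #{e | p e} := by
  have : G.incidenceSet v = Subtype.val '' (({e | p e} : Finset G.edgeSet) : Set G.edgeSet) := by
    ext e
    simp only [mem_incidenceSet, coe_filter, mem_univ, true_and, Set.mem_image]
    exact ⟨fun hi => ⟨⟨e, hi.edge_mem⟩, (h _).1 hi, rfl⟩, by rintro ⟨e, he, rfl⟩; exact (h e).2 he⟩
  rw [edgeDegree, this, Set.ncard_image_of_injective _ Subtype.val_injective,
    Set.ncard_coe_finset]

/-- A `(k, k * r)`-biregular bipartite graph decomposes into `⌈k / 2⌉` interval colorable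
subgraphs. -/
theorem IsBiregularBipartite.intervalThickness_le {G : Graph α β} (hV : G.vertexSet.Finite)
    (hE : G.edgeSet.Finite) {k r : ℕ} (hk : 0 < k) (hr : 0 < r)
    (h : G.IsBiregularBipartite k (k * r)) : G.intervalThickness ≤ ((k + 1) / 2 : ℕ) := by
  classical
  obtain ⟨X, Y, hXY, hX, hY⟩ := h
  have : Fintype G.edgeSet := hE.fintype
  have : Fintype X := (hV.subset (hXY.union_eq ▸ Set.subset_union_left)).fintype
  have : Fintype Y := (hV.subset (hXY.union_eq ▸ Set.subset_union_right)).fintype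
  obtain ⟨f, g, hf, hg⟩ := hXY.exists_ends
  obtain ⟨c, hc, hcf, hcg⟩ := exists_edgeColoring_of_biregular f g univ hr
    (fun x => (edgeDegree_eq_card_filter fun e => hf e x).symm.trans (hX x x.2))
    (fun y => (edgeDegree_eq_card_filter fun e => hg e y).symm.trans (hY y y.2))
  -- Subgraph `i` consists of the color classes `2 * i` and `2 * i + 1`.
  refine G.intervalThickness_le_of_decomposition (by omega)
    (fun i => G.restrict {e | ∃ he : e ∈ G.edgeSet, c ⟨e, he⟩ / 2 = i})
    ⟨fun i => restrict_le, fun i => ?_, fun e he => ?_⟩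
  · have hfilter : ∀ (p : G.edgeSet → Prop) [DecidablePred p] (j : ℕ), j < 2 →
        (univ.filter fun e => c e / 2 = (i : ℕ)).filter (fun e => p e ∧ c e % 2 = j) =
          univ.filter fun e => p e ∧ c e = 2 * (i : ℕ) + j := by
      intro p _ j hj
      ext e
      simp only [mem_filter, mem_univ, true_and]
      constructor
      · rintro ⟨h1, h2, h3⟩
        exact ⟨h2, by omega⟩
      · rintro ⟨h1, h2⟩
        exact ⟨by omega, h1, by omega⟩
    have hi := i.2
    -- The minimum accounts for odd `k`, where the last subgraph has a single layer.
    obtain ⟨t, col, hcol, hcolf, hcolg⟩ := exists_intervalColoring_of_layers f g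
      (univ.filter fun e => c e / 2 = i) (m := min 2 (k - 2 * i)) (r := r)
      (by omega) (by omega) (fun e => c e % 2)
      (fun e he => by
        have h1 := hc e (mem_univ _)
        have h2 := (mem_filter.1 he).2
        omega)
      (fun a j hj => by rw [hfilter _ j (by omega)]; exact hcf a _ (by omega))
      (fun b j hj => by rw [hfilter _ j (by omega)]; exact hcg b _ (by omega))
    let F : β → ℕ := fun e => if he : e ∈ G.edgeSet then col ⟨e, he⟩ else 0
    have hF : ∀ e : G.edgeSet, F e = col e := fun e => by simp [F]
    have hinc : ∀ v ∈ G.vertexSet, ∃ S : Set G.edgeSet, IsIntervalOn col S ∧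
        (G.restrict {e | ∃ he : e ∈ G.edgeSet, c ⟨e, he⟩ / 2 = i}).incidenceSet v =
          Subtype.val '' S := by
      intro v hv
      rw [← hXY.union_eq] at hv
      rcases hv with hv | hv
      · refine ⟨_, hcolf ⟨v, hv⟩, ?_⟩
        ext e
        simp only [mem_incidenceSet, restrict_inc, Set.mem_image, mem_filter, mem_univ, true_and,
          Set.mem_ofPred_eq]
        constructor
        · rintro ⟨h1, he, h2⟩
          exact ⟨⟨e, he⟩, ⟨h2, (hf _ _).1 h1⟩, rfl⟩
        · rintro ⟨e, ⟨h1, h2⟩, rfl⟩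
          exact ⟨(hf e ⟨v, hv⟩).2 h2, e.2, h1⟩
      · refine ⟨_, hcolg ⟨v, hv⟩, ?_⟩
        ext e
        simp only [mem_incidenceSet, restrict_inc, Set.mem_image, mem_filter, mem_univ, true_and,
          Set.mem_ofPred_eq]
        constructor
        · rintro ⟨h1, he, h2⟩
          exact ⟨⟨e, he⟩, ⟨h2, (hg _ _).1 h1⟩, rfl⟩
        · rintro ⟨e, ⟨h1, h2⟩, rfl⟩
          exact ⟨(hg e ⟨v, hv⟩).2 h2, e.2, h1⟩
    refine ⟨t, F, ⟨⟨?_, ?_⟩, ?_⟩⟩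
    · rintro e ⟨-, he, hei⟩
      have := hcol ⟨e, he⟩ (by simpa using hei)
      rwa [← hF ⟨e, he⟩] at this
    · intro v e e' he he' hne heq
      obtain ⟨S, ⟨hS, -⟩, hSv⟩ := hinc v he.vertex_mem
      obtain ⟨e, heS, rfl⟩ : e ∈ Subtype.val '' S := hSv ▸ he
      obtain ⟨e', heS', rfl⟩ : e' ∈ Subtype.val '' S := hSv ▸ he'
      rw [hF, hF] at heq
      exact hne (congrArg _ (hS heS heS' heq))
    · intro v hv
      obtain ⟨S, ⟨-, a, b, hab⟩, hSv⟩ := hinc v hv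
      refine ⟨a, b, ?_⟩
      rw [hSv, Set.image_image, ← hab]
      exact Set.image_congr fun e _ => hF e
  · have hlt := hc ⟨e, he⟩ (mem_univ _)
    refine ⟨⟨c ⟨e, he⟩ / 2, by omega⟩, ⟨he, he, rfl⟩, ?_⟩
    rintro j ⟨-, _, hj⟩
    exact Fin.ext hj.symm

end Graph

theorem mainTheorem8 {α β : Type*} (G : Graph α β)
    (hV : G.vertexSet.Finite) (hE : G.edgeSet.Finite) :
    (∀ r : ℕ, 2 ≤ r → G.IsBiregularBipartite 3 (3 * r) → G.intervalThickness ≤ 2) ∧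
    (∀ k r : ℕ, 4 ≤ k → 2 ≤ r → G.IsBiregularBipartite k (k * r) →
      G.intervalThickness ≤ ((k - 2 : ℕ) : ℕ∞)) := by
  refine ⟨fun r hr h => ?_, fun k r hk hr h => ?_⟩
  · simpa using h.intervalThickness_le hV hE (by omega) (by omega)
  · refine (h.intervalThickness_le hV hE (by omega) (by omega)).trans ?_
    exact_mod_cast (show (k + 1) / 2 ≤ k - 2 by omega)
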